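/- Let $m\ge 2$ be an integer, $\lambda>0$, and let $\mu_0$ be a Borel probability measure on $\mathbb{R}$. Write $\nu^{*k}$ for the $k$-fold convolution of $\nu$ with itself. Then there is exactly one family $(\mu_t)_{t\ge 0}$ of Borel probability measures on $\mathbb{R}$ that solves $$\mu_t=\mu_0+\lambda\int_0^t\bigl(\mu_s^{*m}-\mu_s\bigr)\,ds\qquad (t\ge 0),$$ where the equation means that for every Borel set $B$ and every $t\ge 0$ the function $s\mapsto\mu_s^{*m}(B)-\mu_s(B)$ is integrable on $[0,t]$ and $\mu_t(B)=\mu_0(B)+\lambda\int_0^t(\mu_s^{*m}(B)-\mu_s(B))\,ds$. This solution is the generalized Wild sum $$\mu_t=\sum_{n\ge 1}a_{(m-1)(n-1)+1}\,e^{-\lambda t}\bigl(1-e^{-(m-1)\lambda t}\bigr)^{n-1}\mu_0^{*[(m-1)(n-1)+1]},$$ where the series converges on every Borel set, $a_1=1$ and, for $n>1$, $$a_{(m-1)(n-1)+1}=\frac{1}{m-1}\Bigl(1-\sum_{(i_1,\dots,i_{m-1})}\ \prod_{k=1}^{m-1}a_{(m-1)(i_k-1)+1}\Bigr),$$ the sum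 being over all tuples of integers $1\le i_1,\dots,i_{m-1}<n$ with $i_1+\cdots+i_{m-1}=n+m-2$. -/

import Mathlib

open MeasureTheory
open scoped NNReal

noncomputable section

/-- The `k`-fold convolution `ν * ⋯ * ν` of a measure on `ℝ` (the unit mass at `0` if `k = 0`). -/
def convPow (ν : Measure ℝ) : ℕ → Measure ℝ
  | 0 => Measure.dirac 0
  | k + 1 => (convPow ν k).conv ν

/-- A family `(μ_t)_{t ≥ 0}` of Borel probability measures on `ℝ` solves
`μ_t = μ₀ + lam ∫_0^t (μ_s^{*m} - μ_s) ds`. The equation is one between (signed) measures: it is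
evaluated on every Borel set, and the integral has to make sense there. -/
def IsEvolutionSolution (m : ℕ) (lam : ℝ) (μ₀ : ProbabilityMeasure ℝ)
    (μ : ℝ≥0 → ProbabilityMeasure ℝ) : Prop :=
  ∀ B : Set ℝ, MeasurableSet B → ∀ t : ℝ≥0,
    IntervalIntegrable
      (fun s : ℝ => (convPow (μ s.toNNReal : Measure ℝ) m).real B
        - (μ s.toNNReal : Measure ℝ).real B) volume 0 (t : ℝ) ∧
    (μ t : Measure ℝ).real B = (μ₀ : Measure ℝ).real B +
      lam * ∫ s in (0 : ℝ)..(t : ℝ),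
        ((convPow (μ s.toNNReal : Measure ℝ) m).real B
          - (μ s.toNNReal : Measure ℝ).real B)

/-- `wildCoeff m n`, for `n ≥ 1`, is the coefficient `a_{(m-1)(n-1)+1}`: the coefficient with
`n = 1` is `1`, and for `n > 1` it is `(1 - S) / (m - 1)`, where `S` is the sum of the products
of the coefficients with numbers `i_1, …, i_{m-1}` over all tuples of integers `1 ≤ i_k < n`
whose sum is `n + m - 2`. The value at `n = 0` is never used. -/
def wildCoeff (m : ℕ) : ℕ → ℝ
  | 0 => 0
  | 1 => 1
  | n + 2 =>
    1 / ((m : ℝ) - 1) *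
      (1 - ∑ i : Fin (m - 1) → Fin (n + 2) with
              (∀ k, 1 ≤ (i k : ℕ)) ∧ ∑ k, (i k : ℕ) = (n + 2) + m - 2,
            ∏ k, wildCoeff m (i k))
termination_by n => n
decreasing_by exact (i k).isLt

theorem wildCoeff_one (m : ℕ) : wildCoeff m 1 = 1 := by
  rw [wildCoeff]

theorem wildCoeff_of_one_lt (m n : ℕ) (hn : 1 < n) :
    wildCoeff m n = 1 / ((m : ℝ) - 1) *
      (1 - ∑ i : Fin (m - 1) → Fin n with
              (∀ k, 1 ≤ (i k : ℕ)) ∧ ∑ k, (i k : ℕ) = n + m - 2,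
            ∏ k, wildCoeff m (i k)) := by
  obtain ⟨n, rfl⟩ : ∃ j, n = j + 2 := ⟨n - 2, by omega⟩
  rw [wildCoeff]

end

/-! Put `q = m - 1`, `b_n = a_{qn+1}` and `B(x) = ∑ b_n x^n`. The recursion says exactly that `B^q =
1/(1-x)` (`wildSeries_pow`), and differentiation gives `B^(q+1) = q B'`
(`coeff_wildSeries_pow_succ`). Convolving mixtures of the powers `μ₀^{*(qn+j)}` multiplies the
generating functions of their weights (`convMixture_conv`). At time `s` the Wild sum has generating
function `r B(xz)` in `z`, with `r = e^{-λs}` and `x = 1 - r^q`. The formula for `B^q` gives it mass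
one. The formula for `B^(q+1)` reduces the evolution equation to a scalar equation for each weight
(`hasDerivAt_wildWeight`), which is integrated and summed by dominated convergence.

Uniqueness is a Picard iteration: `ν ↦ ν^{*m}` is `m`-Lipschitz for the supremum over Borel sets, so
two solutions differ by at most `(λ(m+1)t)^n / n!` for every `n`. -/

noncomputable section


/-! ### Generating function of the coefficients -/

open PowerSeries in
/-- The generating function of the Wild coefficients. -/
def wildSeries (m : ℕ) : PowerSeries ℝ := PowerSeries.mk fun n => wildCoeff m (n + 1)

open PowerSeries in
lemma coeff_wildSeries (m n : ℕ) : coeff n (wildSeries m) = wildCoeff m (n + 1) := by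
  simp [wildSeries]

-- For `n > 0`, exponent tuples with an entry `n` have zeros elsewhere and contribute `q b_n`. The
-- others, shifted by one, are the tuples of the recursion, which says that the two parts add up to
-- `1`.
open PowerSeries Finset in
lemma coeff_wildSeries_pow (q : ℕ) (hq : 1 ≤ q) (n : ℕ) :
    coeff n (wildSeries (q + 1) ^ q) = 1 := by
  have hpow : wildSeries (q + 1) ^ q = ∏ _j : Fin q, wildSeries (q + 1) := by simp
  rcases Nat.eq_zero_or_pos n with rfl | hn
  · rw [coeff_zero_eq_constantCoeff_apply, map_pow, ← coeff_zero_eq_constantCoeff_apply,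
      coeff_wildSeries, wildCoeff_one, one_pow]
  rw [hpow, coeff_prod,
    ← sum_filter_add_sum_filter_not _ (fun l : Fin q →₀ ℕ => ∃ k, l k = n)]
  have h1 : ∑ l ∈ (finsuppAntidiag (univ : Finset (Fin q)) n).filter (fun l => ∃ k, l k = n),
      ∏ i, coeff (l i) (wildSeries (q + 1)) = q * wildCoeff (q + 1) (n + 1) := by
    have : ∑ k : Fin q, wildCoeff (q + 1) (n + 1) = q * wildCoeff (q + 1) (n + 1) := by simp
    rw [← this]
    symm
    refine sum_bij (fun k _ => Finsupp.single k n) ?_ ?_ ?_ ?_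
    · intro k _
      simp only [mem_filter, mem_finsuppAntidiag, subset_univ, and_true]
      exact ⟨by simp [Finsupp.single_apply], k, by simp⟩
    · intro k _ k' _ h
      exact Finsupp.single_left_injective hn.ne' h
    · intro l hl
      simp only [mem_filter, mem_finsuppAntidiag, subset_univ, and_true] at hl
      obtain ⟨hs, k, hk⟩ := hl
      refine ⟨k, mem_univ k, ?_⟩
      ext j
      by_cases hj : k = j
      · simp [← hj, hk]
      · have := add_le_sum (fun i _ => Nat.zero_le (l i)) (mem_univ k) (mem_univ j) hj
        have hs' : ∑ i, l i = n := hs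
        rw [Finsupp.single_apply, if_neg hj]
        omega
    · intro k _
      rw [prod_eq_single k]
      · simp [coeff_wildSeries]
      · intro j _ hj
        rw [Finsupp.single_apply, if_neg hj.symm, coeff_wildSeries, wildCoeff_one]
      · simp
  have h2 : ∑ l ∈ (finsuppAntidiag (univ : Finset (Fin q)) n).filter (fun l => ¬ ∃ k, l k = n),
      ∏ i, coeff (l i) (wildSeries (q + 1)) =
      ∑ i : Fin q → Fin (n + 1) with
        (∀ k, 1 ≤ (i k : ℕ)) ∧ ∑ k, (i k : ℕ) = (n + 1) + (q + 1) - 2,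
          ∏ k, wildCoeff (q + 1) (i k) := by
    symm
    refine sum_bij (fun i _ => Finsupp.equivFunOnFinite.symm fun k => (i k : ℕ) - 1)
      ?_ ?_ ?_ ?_
    · intro i hi
      simp only [mem_filter, mem_univ, true_and] at hi
      simp only [mem_filter, mem_finsuppAntidiag, subset_univ, and_true,
        Finsupp.coe_equivFunOnFinite_symm, not_exists]
      refine ⟨?_, fun k => ?_⟩
      · have : ∑ k, ((i k : ℕ) - 1) + ∑ k : Fin q, 1 = ∑ k, (i k : ℕ) := by
          rw [← sum_add_distrib]
          exact sum_congr rfl fun k _ => Nat.sub_add_cancel (hi.1 k)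
        rw [hi.2] at this
        simp at this
        omega
      · have := (i k).isLt
        omega
    · intro i hi j hj h
      simp only [mem_filter, mem_univ, true_and] at hi hj
      ext k
      have := DFunLike.congr_fun h k
      simp only [Finsupp.coe_equivFunOnFinite_symm] at this
      have := hi.1 k
      have := hj.1 k
      omega
    · intro l hl
      simp only [mem_filter, mem_finsuppAntidiag, subset_univ, and_true, not_exists] at hl
      have hlt : ∀ k, l k + 1 < n + 1 := fun k => by
        have h1 : l k ≤ ∑ i, l i := single_le_sum (fun i _ => Nat.zero_le (l i)) (mem_univ k)
        have h2 : ∑ i, l i = n := hl.1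
        have := hl.2 k
        omega
      refine ⟨fun k => ⟨l k + 1, hlt k⟩, ?_, ?_⟩
      · simp only [mem_filter, mem_univ, true_and]
        refine ⟨fun k => by simp, ?_⟩
        rw [sum_add_distrib, hl.1]
        simp
        omega
      · ext k
        simp
    · intro i hi
      simp only [mem_filter, mem_univ, true_and] at hi
      refine prod_congr rfl fun k _ => ?_
      rw [coeff_wildSeries, Finsupp.coe_equivFunOnFinite_symm, Nat.sub_add_cancel (hi.1 k)]
  have h3 : wildCoeff (q + 1) (n + 1) = 1 / (((q + 1 : ℕ) : ℝ) - 1) *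
      (1 - ∑ i : Fin q → Fin (n + 1) with
        (∀ k, 1 ≤ (i k : ℕ)) ∧ ∑ k, (i k : ℕ) = (n + 1) + (q + 1) - 2,
          ∏ k, wildCoeff (q + 1) (i k)) :=
    wildCoeff_of_one_lt (q + 1) (n + 1) (by omega)
  rw [h1, h2]
  have hq' : (q : ℝ) ≠ 0 := by positivity
  rw [h3, Nat.cast_succ, add_sub_cancel_right, ← mul_assoc, mul_one_div_cancel hq']
  ring

open PowerSeries in
lemma wildSeries_pow (q : ℕ) (hq : 1 ≤ q) :
    wildSeries (q + 1) ^ q = PowerSeries.mk 1 := by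
  ext n
  simp [coeff_wildSeries_pow q hq]

open PowerSeries in
lemma coeff_wildSeries_pow_succ (q : ℕ) (hq : 1 ≤ q) (n : ℕ) :
    coeff n (wildSeries (q + 1) ^ (q + 1)) = q * (n + 1) * wildCoeff (q + 1) (n + 2) := by
  have h1 : wildSeries (q + 1) ^ q * (1 - X) = 1 := by
    rw [wildSeries_pow q hq]
    exact mk_one_mul_one_sub_eq_one ℝ
  set B := wildSeries (q + 1)
  have h2 := congrArg (derivative ℝ) h1
  simp only [Derivation.leibniz, Derivation.leibniz_pow, map_sub, Derivation.map_one_eq_zero,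
    derivative_X, smul_eq_mul, nsmul_eq_mul] at h2
  have h3 : B ^ (q + 1) = (q : ℝ⟦X⟧) * derivative ℝ B := by
    obtain ⟨p, rfl⟩ : ∃ p, q = p + 1 := ⟨q - 1, by omega⟩
    simp only [Nat.add_sub_cancel] at h2
    -- `h2` reads `q B^(q-1) B' (1-X) = B^q`; after multiplication by `B`, the factor `B^q (1-X)` is
    -- `1`.
    linear_combination (-B) * h2 +
      ((p + 1 : ℕ) : ℝ⟦X⟧) * (derivative ℝ B) * h1
  rw [h3, ← map_natCast (C (R := ℝ)), coeff_C_mul, coeff_derivative, coeff_wildSeries]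
  ring

-- Since `B^(q+1) = B/(1-X)`, the previous identity becomes `q(n+1) b_(n+1) = b_0 + ⋯ + b_n`. The
-- signs are not visible in the defining recursion; they allow weights in `ℝ≥0`.
open PowerSeries in
lemma wildCoeff_nonneg (q : ℕ) (hq : 1 ≤ q) (n : ℕ) : 0 ≤ wildCoeff (q + 1) (n + 1) := by
  induction n using Nat.strong_induction_on with
  | _ n ih =>
    rcases n with _ | n
    · simp [wildCoeff_one]
    · have h := coeff_wildSeries_pow_succ q hq n
      rw [pow_succ, wildSeries_pow q hq, coeff_mul] at h
      have h0 : 0 ≤ (q : ℝ) * (n + 1) * wildCoeff (q + 1) (n + 2) := by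
        rw [← h]
        refine Finset.sum_nonneg fun p hp => ?_
        rw [coeff_wildSeries]
        have := Finset.HasAntidiagonal.mem_antidiagonal.1 hp
        simpa using ih p.2 (by omega)
      have : 0 < (q : ℝ) * (n + 1) := by positivity
      exact nonneg_of_mul_nonneg_right h0 this


/-! ### Convolution powers and their mixtures -/

instance sFinite_convPow (ν : Measure ℝ) [SFinite ν] (k : ℕ) : SFinite (convPow ν k) := by
  induction k with
  | zero => rw [convPow]; infer_instance
  | succ k ih => rw [convPow]; infer_instance

instance isProbabilityMeasure_convPow (ν : Measure ℝ) [IsProbabilityMeasure ν] (k : ℕ) :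
    IsProbabilityMeasure (convPow ν k) := by
  induction k with
  | zero => rw [convPow]; infer_instance
  | succ k ih => rw [convPow]; infer_instance

lemma convPow_conv_convPow (ν : Measure ℝ) [SFinite ν] (j k : ℕ) :
    (convPow ν j).conv (convPow ν k) = convPow ν (j + k) := by
  induction k with
  | zero => simp [convPow]
  | succ k ih => rw [convPow, ← Measure.conv_assoc, ih, ← add_assoc, convPow]

lemma convPow_one (ν : Measure ℝ) [SFinite ν] : convPow ν 1 = ν := by
  simp [convPow]

lemma convPow_univ (ν : Measure ℝ) [SFinite ν] (k : ℕ) :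
    convPow ν k Set.univ = ν Set.univ ^ k := by
  induction k with
  | zero => simp [convPow]
  | succ k ih =>
    rw [convPow, Measure.conv, Measure.map_apply measurable_add MeasurableSet.univ,
      Set.preimage_univ, ← Set.univ_prod_univ, Measure.prod_prod, ih, pow_succ]

/-- The mixture of the convolution powers `ν^{*(q n + j)}` with the coefficients of `C` as
weights. -/
def convMixture (ν : Measure ℝ) (q j : ℕ) (C : PowerSeries ℝ≥0) : Measure ℝ :=
  Measure.sum fun n => ((PowerSeries.coeff n C : ℝ≥0) : ENNReal) • convPow ν (q * n + j)

instance sFinite_convMixture (ν : Measure ℝ) [SFinite ν] (q j : ℕ) (C : PowerSeries ℝ≥0) :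
    SFinite (convMixture ν q j C) := by
  rw [convMixture]; infer_instance

lemma convMixture_apply (ν : Measure ℝ) (q j : ℕ) (C : PowerSeries ℝ≥0) {B : Set ℝ}
    (hB : MeasurableSet B) :
    convMixture ν q j C B =
      ∑' n, ((PowerSeries.coeff n C : ℝ≥0) : ENNReal) * convPow ν (q * n + j) B := by
  simp [convMixture, Measure.sum_apply _ hB]

lemma convMixture_conv (ν : Measure ℝ) [SFinite ν] (q j k : ℕ) (C D : PowerSeries ℝ≥0) :
    (convMixture ν q j C).conv (convMixture ν q k D) = convMixture ν q (j + k) (C * D) := by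
  ext B hB
  rw [convMixture_apply _ _ _ _ hB, convMixture, convMixture, Measure.conv, Measure.prod_sum,
    Measure.map_sum measurable_add.aemeasurable, Measure.sum_apply _ hB,
    ← Finset.HasAntidiagonal.sigmaAntidiagonalEquivProd.tsum_eq, ENNReal.tsum_sigma']
  refine tsum_congr fun n => ?_
  rw [tsum_fintype, PowerSeries.coeff_mul, ENNReal.ofNNReal_finsetSum, Finset.sum_mul,
    ← Finset.sum_coe_sort (Finset.HasAntidiagonal.antidiagonal n)]
  apply Finset.sum_congr rfl
  rintro p -
  have hp := Finset.HasAntidiagonal.mem_antidiagonal.1 p.2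
  have h := convPow_conv_convPow ν (q * p.1.1 + j) (q * p.1.2 + k)
  rw [show q * p.1.1 + j + (q * p.1.2 + k) = q * n + (j + k) by
    linear_combination q * hp] at h
  rw [← h, ENNReal.coe_mul, mul_assoc]
  change (((((PowerSeries.coeff p.1.1 C : ℝ≥0) : ENNReal) • convPow ν (q * p.1.1 + j)).conv
    (((PowerSeries.coeff p.1.2 D : ℝ≥0) : ENNReal) • convPow ν (q * p.1.2 + k)))) B = _
  rw [Measure.conv_smul_left, Measure.conv_smul_right]
  simp only [Measure.smul_apply, smul_eq_mul]

lemma convPow_convMixture (ν : Measure ℝ) [SFinite ν] (q : ℕ) (C : PowerSeries ℝ≥0) (k : ℕ) :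
    convPow (convMixture ν q 1 C) k = convMixture ν q k (C ^ k) := by
  induction k with
  | zero =>
    ext B hB
    rw [convMixture_apply _ _ _ _ hB, tsum_eq_single 0]
    · simp [convPow]
    · intro n hn
      simp [PowerSeries.coeff_one, hn]
  | succ k ih => rw [convPow, ih, convMixture_conv, pow_succ]

/-- The generating function of the Wild coefficients, over the nonnegative reals. -/
def wildSeriesNNReal (m : ℕ) : PowerSeries ℝ≥0 :=
  PowerSeries.mk fun n => (wildCoeff m (n + 1)).toNNReal

lemma map_wildSeriesNNReal (q : ℕ) (hq : 1 ≤ q) :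
    PowerSeries.map NNReal.toRealHom (wildSeriesNNReal (q + 1)) = wildSeries (q + 1) := by
  ext n
  simp [wildSeriesNNReal, coeff_wildSeries, wildCoeff_nonneg q hq]

lemma coe_coeff_wildSeriesNNReal_pow (q : ℕ) (hq : 1 ≤ q) (n k : ℕ) :
    ((PowerSeries.coeff n (wildSeriesNNReal (q + 1) ^ k) : ℝ≥0) : ℝ) =
      PowerSeries.coeff n (wildSeries (q + 1) ^ k) := by
  rw [← map_wildSeriesNNReal q hq, ← map_pow, PowerSeries.coeff_map]
  rfl

/-- The weights `b_n r xⁿ` of the Wild sum, with `b_n` the Wild coefficients. -/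
def wildWeights (m : ℕ) (r x : ℝ≥0) : PowerSeries ℝ≥0 :=
  PowerSeries.C r * PowerSeries.rescale x (wildSeriesNNReal m)

lemma coeff_wildWeights_pow (m : ℕ) (r x : ℝ≥0) (k n : ℕ) :
    PowerSeries.coeff n (wildWeights m r x ^ k) =
      r ^ k * x ^ n * PowerSeries.coeff n (wildSeriesNNReal m ^ k) := by
  rw [wildWeights, mul_pow, ← map_pow, ← map_pow, PowerSeries.coeff_C_mul,
    PowerSeries.coeff_rescale, mul_assoc]

/-- The `q`-th convolution power has mass `r^q ∑ x^n = r^q/(1-x) = 1`, and the mass itself is the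
`q`-th root of this. -/
lemma isProbabilityMeasure_convMixture_wildWeights (ν : Measure ℝ) [IsProbabilityMeasure ν]
    (q : ℕ) (hq : 1 ≤ q) (r x : ℝ≥0) (hr : r ≠ 0) (hx : r ^ q + x = 1) :
    IsProbabilityMeasure (convMixture ν q 1 (wildWeights (q + 1) r x)) := by
  refine ⟨?_⟩
  have h := convPow_univ (convMixture ν q 1 (wildWeights (q + 1) r x)) q
  rw [convPow_convMixture, convMixture_apply _ _ _ _ MeasurableSet.univ] at h
  have h1 : ∀ n, PowerSeries.coeff n (wildWeights (q + 1) r x ^ q) = r ^ q * x ^ n := by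
    intro n
    have : PowerSeries.coeff n (wildSeriesNNReal (q + 1) ^ q) = 1 := by
      apply NNReal.coe_injective
      rw [coe_coeff_wildSeriesNNReal_pow q hq, coeff_wildSeries_pow q hq, NNReal.coe_one]
    rw [coeff_wildWeights_pow, this, mul_one]
  simp only [h1, measure_univ, mul_one, ENNReal.coe_mul, ENNReal.coe_pow] at h
  rw [ENNReal.tsum_mul_left, ENNReal.tsum_geometric] at h
  have hx' : (r : ENNReal) ^ q = 1 - x := by
    have : (r : ENNReal) ^ q + x = 1 := by exact_mod_cast hx
    rw [← this, ENNReal.add_sub_cancel_right ENNReal.coe_ne_top]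
  rw [← hx', ENNReal.mul_inv_cancel (by positivity) (by simp)] at h
  exact (ENNReal.pow_right_strictMono (by omega)).injective (h.symm.trans (one_pow q).symm)


/-! ### Uniqueness -/

lemma conv_real_eq_integral (α β : Measure ℝ) [IsProbabilityMeasure α] [IsProbabilityMeasure β]
    {B : Set ℝ} (hB : MeasurableSet B) :
    (α.conv β).real B = ∫ x, β.real ((fun y => x + y) ⁻¹' B) ∂α := by
  have hS : MeasurableSet ((fun p : ℝ × ℝ => p.1 + p.2) ⁻¹' B) := measurable_add hB
  have h := integral_toReal (μ := α) (measurable_measure_prodMk_left (ν := β) hS).aemeasurable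
    (Filter.Eventually.of_forall fun x => measure_lt_top _ _)
  rw [Measure.real, Measure.conv, Measure.map_apply measurable_add hB, Measure.prod_apply hS, ← h]
  rfl

lemma integrable_real_preimage_add (α β : Measure ℝ) [IsProbabilityMeasure α]
    [IsProbabilityMeasure β] {B : Set ℝ} (hB : MeasurableSet B) :
    Integrable (fun x => β.real ((fun y => x + y) ⁻¹' B)) α := by
  have hS : MeasurableSet ((fun p : ℝ × ℝ => p.1 + p.2) ⁻¹' B) := measurable_add hB
  refine Integrable.of_bound
    (measurable_measure_prodMk_left (ν := β) hS).ennreal_toReal.aestronglyMeasurable 1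
    (Filter.Eventually.of_forall fun x => ?_)
  rw [Real.norm_eq_abs, abs_of_nonneg measureReal_nonneg]
  exact measureReal_le_one

lemma abs_conv_real_sub_le (α β β' : Measure ℝ) [IsProbabilityMeasure α]
    [IsProbabilityMeasure β] [IsProbabilityMeasure β'] {b : ℝ}
    (hb : ∀ B, MeasurableSet B → |β.real B - β'.real B| ≤ b) {B : Set ℝ} (hB : MeasurableSet B) :
    |(α.conv β).real B - (α.conv β').real B| ≤ b := by
  rw [conv_real_eq_integral α β hB, conv_real_eq_integral α β' hB,
    ← integral_sub (integrable_real_preimage_add α β hB) (integrable_real_preimage_add α β' hB),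
    ← Real.norm_eq_abs]
  refine (norm_integral_le_of_norm_le_const (C := b)
    (Filter.Eventually.of_forall fun x => hb _ (measurable_const_add x hB))).trans ?_
  simp

lemma abs_convPow_real_sub_le (ν ν' : Measure ℝ) [IsProbabilityMeasure ν]
    [IsProbabilityMeasure ν'] {b : ℝ}
    (hb : ∀ B, MeasurableSet B → |ν.real B - ν'.real B| ≤ b) (k : ℕ) :
    ∀ B, MeasurableSet B → |(convPow ν k).real B - (convPow ν' k).real B| ≤ k * b := by
  induction k with
  | zero => intro B _; simp [convPow]
  | succ k ih =>
    intro B hB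
    have h1 := abs_conv_real_sub_le (convPow ν k) ν ν' hb hB
    have h2 := abs_conv_real_sub_le ν' (convPow ν k) (convPow ν' k) ih hB
    -- Factors are exchanged one at a time; commutativity moves the changed factor to the right.
    rw [Measure.conv_comm ν', Measure.conv_comm ν'] at h2
    rw [convPow, convPow, Nat.cast_succ]
    have h3 := abs_sub_le ((convPow ν k ∗ ν).real B) ((convPow ν k ∗ ν').real B)
      ((convPow ν' k ∗ ν').real B)
    linarith

lemma IsEvolutionSolution.abs_sub_le {m : ℕ} {lam : ℝ} (hlam : 0 < lam)
    {μ₀ : ProbabilityMeasure ℝ} {μ μ' : ℝ≥0 → ProbabilityMeasure ℝ}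
    (h : IsEvolutionSolution m lam μ₀ μ) (h' : IsEvolutionSolution m lam μ₀ μ') (n : ℕ) :
    ∀ (t : ℝ≥0) (B : Set ℝ), MeasurableSet B →
      |(μ t : Measure ℝ).real B - (μ' t : Measure ℝ).real B| ≤
        (lam * (m + 1) * t) ^ n / n.factorial := by
  induction n with
  | zero =>
    intro t B _
    have h1 : (μ t : Measure ℝ).real B ≤ 1 := measureReal_le_one
    have h2 : (μ' t : Measure ℝ).real B ≤ 1 := measureReal_le_one
    have h3 : 0 ≤ (μ t : Measure ℝ).real B := measureReal_nonneg
    have h4 : 0 ≤ (μ' t : Measure ℝ).real B := measureReal_nonneg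
    rw [pow_zero, Nat.factorial_zero, Nat.cast_one, div_one, abs_le]
    constructor <;> linarith
  | succ n ih =>
    intro t B hB
    obtain ⟨hi, he⟩ := h B hB t
    obtain ⟨hi', he'⟩ := h' B hB t
    rw [he, he', add_sub_add_left_eq_sub, ← mul_sub, ← intervalIntegral.integral_sub hi hi',
      abs_mul, abs_of_pos hlam]
    set L : ℝ := lam * (m + 1) with hL
    clear_value L
    -- In the factor `m + 1`, `m` comes from the convolution power and `1` from the loss term.
    have hg : IntervalIntegrable (fun s : ℝ => (m + 1) * L ^ n / n.factorial * s ^ n)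
        volume 0 (t : ℝ) := (by fun_prop : Continuous _).intervalIntegrable _ _
    have hle := intervalIntegral.norm_integral_le_of_norm_le (μ := volume) t.2
      (f := fun s : ℝ => ((convPow (μ s.toNNReal : Measure ℝ) m).real B
          - (μ s.toNNReal : Measure ℝ).real B) - ((convPow (μ' s.toNNReal : Measure ℝ) m).real B
          - (μ' s.toNNReal : Measure ℝ).real B)) (Filter.Eventually.of_forall fun s hs => by
        have h1 := abs_convPow_real_sub_le _ _ (ih s.toNNReal) m B hB
        have h2 := ih s.toNNReal B hB
        rw [Real.coe_toNNReal s hs.1.le] at h1 h2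
        rw [Real.norm_eq_abs, sub_sub_sub_comm]
        refine (abs_sub _ _).trans ((add_le_add h1 h2).trans (le_of_eq ?_))
        ring) hg
    rw [intervalIntegral.integral_const_mul, integral_pow] at hle
    refine (mul_le_mul_of_nonneg_left hle hlam.le).trans (le_of_eq ?_)
    rw [Nat.factorial_succ,
      show (L * t) ^ (n + 1) = L ^ n * (lam * (m + 1)) * t ^ (n + 1) by
        rw [mul_pow, pow_succ L n, ← hL]]
    push_cast
    have : (n.factorial : ℝ) ≠ 0 := by positivity
    have : (n : ℝ) + 1 ≠ 0 := by positivity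
    field_simp
    simp

lemma IsEvolutionSolution.unique {m : ℕ} {lam : ℝ} (hlam : 0 < lam)
    {μ₀ : ProbabilityMeasure ℝ} {μ μ' : ℝ≥0 → ProbabilityMeasure ℝ}
    (h : IsEvolutionSolution m lam μ₀ μ) (h' : IsEvolutionSolution m lam μ₀ μ') : μ = μ' := by
  funext t
  apply Subtype.ext
  ext B hB
  have h0 := ge_of_tendsto' (FloorSemiring.tendsto_pow_div_factorial_atTop (lam * (m + 1) * t : ℝ))
    fun n => h.abs_sub_le hlam h' n t B hB
  have h1 := sub_eq_zero.1 (abs_nonpos_iff.1 h0)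
  exact (measureReal_eq_measureReal_iff (measure_ne_top (μ t : Measure ℝ) B)
    (measure_ne_top (μ' t : Measure ℝ) B)).1 h1


/-! ### Existence: the Wild sum -/

lemma hasSum_convMixture_real (ν : Measure ℝ) [IsProbabilityMeasure ν] (q j : ℕ)
    (C : PowerSeries ℝ≥0) [IsFiniteMeasure (convMixture ν q j C)] {B : Set ℝ}
    (hB : MeasurableSet B) :
    HasSum (fun n => ((PowerSeries.coeff n C : ℝ≥0) : ℝ) * (convPow ν (q * n + j)).real B)
      ((convMixture ν q j C).real B) := by
  have h := convMixture_apply ν q j C hB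
  have hf := measure_ne_top (convMixture ν q j C) B
  rw [h] at hf
  have := ENNReal.hasSum_toReal hf
  rw [← ENNReal.tsum_toReal_eq fun n => ENNReal.ne_top_of_tsum_ne_top hf n, ← h] at this
  simpa [Measure.real] using this

/-- The weight of `μ₀^{*(q n + 1)}` in the Wild sum at time `s`. -/
def wildWeight (q : ℕ) (lam : ℝ) (n : ℕ) (s : ℝ) : ℝ :=
  wildCoeff (q + 1) (n + 1) * Real.exp (-(lam * s)) * (1 - Real.exp (-(q * lam * s))) ^ n

/-- The weight of `μ₀^{*(q n + 1)}` in the `(q + 1)`-fold convolution of the Wild sum at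
time `s`. -/
def wildGain (q : ℕ) (lam : ℝ) : ℕ → ℝ → ℝ
  | 0, _ => 0
  | n + 1, s => Real.exp (-(lam * s)) ^ (q + 1) * (1 - Real.exp (-(q * lam * s))) ^ n *
      (q * (n + 1) * wildCoeff (q + 1) (n + 2))

lemma continuous_wildWeight (q : ℕ) (lam : ℝ) (n : ℕ) : Continuous (wildWeight q lam n) := by
  unfold wildWeight
  fun_prop

lemma continuous_wildGain (q : ℕ) (lam : ℝ) (n : ℕ) : Continuous (wildGain q lam n) := by
  cases n <;> unfold wildGain <;> fun_prop

lemma hasDerivAt_wildWeight (q : ℕ) (lam : ℝ) (n : ℕ) (s : ℝ) :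
    HasDerivAt (wildWeight q lam n) (lam * (wildGain q lam n s - wildWeight q lam n s)) s := by
  have h1 : HasDerivAt (fun s : ℝ => Real.exp (-(lam * s))) (Real.exp (-(lam * s)) * -lam) s := by
    simpa using (((hasDerivAt_id s).const_mul lam).neg).exp
  have h2 : HasDerivAt (fun s : ℝ => 1 - Real.exp (-(q * lam * s)))
      (Real.exp (-(q * lam * s)) * (q * lam)) s := by
    simpa using (((hasDerivAt_id s).const_mul (q * lam)).neg).exp.const_sub 1
  have h3 := (h1.const_mul (wildCoeff (q + 1) (n + 1))).mul (h2.pow n)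
  refine h3.congr_deriv ?_
  have he : Real.exp (-(q * lam * s)) = Real.exp (-(lam * s)) ^ q := by
    rw [← Real.exp_nat_mul]
    ring_nf
  rcases n with _ | n
  · simp [wildGain, wildWeight]
    ring
  · simp only [wildGain, wildWeight, Nat.add_sub_cancel, he, Pi.pow_apply]
    push_cast
    ring

lemma one_sub_exp_nonneg {q : ℕ} {lam s : ℝ} (hlam : 0 < lam) (hs : 0 ≤ s) :
    0 ≤ 1 - Real.exp (-(q * lam * s)) :=
  sub_nonneg.2 (Real.exp_le_one_iff.2 (neg_nonpos.2 (by positivity)))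

lemma wildWeight_nonneg {q : ℕ} (hq : 1 ≤ q) {lam s : ℝ} (hlam : 0 < lam) (hs : 0 ≤ s) (n : ℕ) :
    0 ≤ wildWeight q lam n s := by
  have := wildCoeff_nonneg q hq n
  have := one_sub_exp_nonneg (q := q) hlam hs
  unfold wildWeight
  positivity

lemma wildGain_nonneg {q : ℕ} (hq : 1 ≤ q) {lam s : ℝ} (hlam : 0 < lam) (hs : 0 ≤ s) (n : ℕ) :
    0 ≤ wildGain q lam n s := by
  rcases n with _ | n
  · exact le_rfl
  · have := wildCoeff_nonneg q hq (n + 1)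
    have := one_sub_exp_nonneg (q := q) hlam hs
    unfold wildGain
    positivity

/-- The Wild sum at time `s`. -/
def wildMeasure (q : ℕ) (lam : ℝ) (ν : Measure ℝ) (s : ℝ) : Measure ℝ :=
  convMixture ν q 1 (wildWeights (q + 1) (Real.exp (-(lam * s))).toNNReal
    (1 - Real.exp (-(q * lam * s))).toNNReal)

lemma isProbabilityMeasure_wildMeasure {q : ℕ} (hq : 1 ≤ q) {lam s : ℝ} (hlam : 0 < lam)
    (hs : 0 ≤ s) (ν : Measure ℝ) [IsProbabilityMeasure ν] :
    IsProbabilityMeasure (wildMeasure q lam ν s) := by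
  refine isProbabilityMeasure_convMixture_wildWeights ν q hq _ _ ?_ ?_
  · simp [Real.exp_pos]
  · apply NNReal.coe_injective
    push_cast
    rw [Real.coe_toNNReal _ (Real.exp_pos _).le,
      Real.coe_toNNReal _ (one_sub_exp_nonneg hlam hs), ← Real.exp_nat_mul]
    ring_nf

lemma hasSum_wildMeasure {q : ℕ} (hq : 1 ≤ q) {lam s : ℝ} (hlam : 0 < lam) (hs : 0 ≤ s)
    (ν : Measure ℝ) [IsProbabilityMeasure ν] {B : Set ℝ} (hB : MeasurableSet B) :
    HasSum (fun n => wildWeight q lam n s * (convPow ν (q * n + 1)).real B)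
      ((wildMeasure q lam ν s).real B) := by
  have := isProbabilityMeasure_wildMeasure hq hlam hs ν
  unfold wildMeasure at *
  have hS := hasSum_convMixture_real ν q 1 (wildWeights (q + 1) (Real.exp (-(lam * s))).toNNReal
    (1 - Real.exp (-(q * lam * s))).toNNReal) hB
  have hc : ∀ r x n, ((PowerSeries.coeff n (wildWeights (q + 1) r x) : ℝ≥0) : ℝ) =
      r * x ^ n * wildCoeff (q + 1) (n + 1) := fun r x n => by
    have h := coeff_wildWeights_pow (q + 1) r x 1 n
    rw [pow_one, pow_one] at h
    rw [h, NNReal.coe_mul, coe_coeff_wildSeriesNNReal_pow q hq, pow_one, coeff_wildSeries]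
    push_cast
    rfl
  simp only [hc, Real.coe_toNNReal _ (Real.exp_pos _).le,
    Real.coe_toNNReal _ (one_sub_exp_nonneg hlam hs)] at hS
  convert hS using 3
  rw [wildWeight]
  ring

lemma hasSum_convPow_wildMeasure {q : ℕ} (hq : 1 ≤ q) {lam s : ℝ} (hlam : 0 < lam) (hs : 0 ≤ s)
    (ν : Measure ℝ) [IsProbabilityMeasure ν] {B : Set ℝ} (hB : MeasurableSet B) :
    HasSum (fun n => wildGain q lam n s * (convPow ν (q * n + 1)).real B)
      ((convPow (wildMeasure q lam ν s) (q + 1)).real B) := by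
  have h1 := isProbabilityMeasure_wildMeasure hq hlam hs ν
  have h2 := isProbabilityMeasure_convPow (wildMeasure q lam ν s) (q + 1)
  -- The convolution starts at `ν^{*(q+1)}`, which has index `1` in the numbering `qn + 1`.
  rw [← hasSum_nat_add_iff' 1]
  simp only [Finset.sum_range_one, wildGain, zero_mul, sub_zero]
  unfold wildMeasure at *
  rw [convPow_convMixture] at *
  have hS := hasSum_convMixture_real ν q (q + 1) (wildWeights (q + 1)
    (Real.exp (-(lam * s))).toNNReal (1 - Real.exp (-(q * lam * s))).toNNReal ^ (q + 1)) hB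
  have he : ∀ n, q * n + (q + 1) = q * (n + 1) + 1 := fun n => by ring
  simp only [coeff_wildWeights_pow, NNReal.coe_mul, NNReal.coe_pow,
    coe_coeff_wildSeriesNNReal_pow q hq, coeff_wildSeries_pow_succ q hq,
    Real.coe_toNNReal _ (Real.exp_pos _).le, Real.coe_toNNReal _ (one_sub_exp_nonneg hlam hs),
    he] at hS
  exact hS

lemma wildMeasure_isEvolutionSolution {q : ℕ} (hq : 1 ≤ q) {lam : ℝ} (hlam : 0 < lam)
    (μ₀ : ProbabilityMeasure ℝ) :
    IsEvolutionSolution (q + 1) lam μ₀ fun t : ℝ≥0 =>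
      ⟨wildMeasure q lam μ₀ t, isProbabilityMeasure_wildMeasure hq hlam t.coe_nonneg μ₀⟩ := by
  intro B hB t
  set f : ℝ → ℝ := fun s =>
    (convPow (wildMeasure q lam μ₀ (s.toNNReal : ℝ)) (q + 1)).real B -
      (wildMeasure q lam μ₀ (s.toNNReal : ℝ)).real B with hf
  change IntervalIntegrable f volume 0 t ∧ (wildMeasure q lam μ₀ t).real B =
    (μ₀ : Measure ℝ).real B + lam * ∫ s in (0 : ℝ)..t, f s
  set p : ℕ → ℝ := fun n => (convPow (μ₀ : Measure ℝ) (q * n + 1)).real B with hp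
  set F : ℕ → ℝ → ℝ := fun n s => (wildGain q lam n s - wildWeight q lam n s) * p n with hF
  have hFc : ∀ n, Continuous (F n) := fun n =>
    ((continuous_wildGain q lam n).sub (continuous_wildWeight q lam n)).mul_const _
  have hpos : ∀ s ∈ Set.uIoc (0 : ℝ) t, 0 ≤ s := fun s hs => by
    rw [Set.uIoc_of_le t.coe_nonneg] at hs
    exact hs.1.le
  have hsum : ∀ s ∈ Set.uIoc (0 : ℝ) t, HasSum (fun n => F n s) (f s) := fun s hs => by
    simp only [hF, hf, sub_mul, Real.coe_toNNReal s (hpos s hs)]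
    exact (hasSum_convPow_wildMeasure hq hlam (hpos s hs) _ hB).sub
      (hasSum_wildMeasure hq hlam (hpos s hs) _ hB)
  -- Taking the whole line as Borel set, the two series sum to the total masses, `1` each.
  have hbd : ∀ s ∈ Set.uIoc (0 : ℝ) t,
      HasSum (fun n => wildGain q lam n s + wildWeight q lam n s) 2 := fun s hs => by
    have h1 := hasSum_convPow_wildMeasure hq hlam (hpos s hs) (μ₀ : Measure ℝ) MeasurableSet.univ
    have h2 := hasSum_wildMeasure hq hlam (hpos s hs) (μ₀ : Measure ℝ) MeasurableSet.univ
    have := isProbabilityMeasure_wildMeasure hq hlam (hpos s hs) (μ₀ : Measure ℝ)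
    simp only [probReal_univ, mul_one] at h1 h2
    simpa [one_add_one_eq_two] using h1.add h2
  have hFle : ∀ n, ∀ s ∈ Set.uIoc (0 : ℝ) t,
      ‖F n s‖ ≤ wildGain q lam n s + wildWeight q lam n s := fun n s hs => by
    have h1 := wildGain_nonneg hq hlam (hpos s hs) n
    have h2 := wildWeight_nonneg hq hlam (hpos s hs) n
    have h3 : 0 ≤ p n := measureReal_nonneg
    have h4 : p n ≤ 1 := measureReal_le_one
    rw [hF, norm_mul, Real.norm_eq_abs, Real.norm_eq_abs, abs_of_nonneg h3]
    refine (mul_le_of_le_one_right (abs_nonneg _) h4).trans ?_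
    rw [abs_le]
    constructor <;> linarith
  have hint : HasSum (fun n => ∫ s in (0 : ℝ)..t, F n s) (∫ s in (0 : ℝ)..t, f s) := by
    refine intervalIntegral.hasSum_integral_of_dominated_convergence
      (fun n s => wildGain q lam n s + wildWeight q lam n s)
      (fun n => (hFc n).aestronglyMeasurable)
      (fun n => Filter.Eventually.of_forall (hFle n))
      (Filter.Eventually.of_forall fun s hs => (hbd s hs).summable) ?_
      (Filter.Eventually.of_forall hsum)
    exact (intervalIntegrable_const (c := (2 : ℝ))).congr fun s hs => ((hbd s hs).tsum_eq).symm
  constructor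
  · rw [intervalIntegrable_iff]
    refine IntegrableOn.of_bound (C := 2) (by simp) ?_ ?_
    -- Measurability of `f` in time comes from the continuous partial sums.
    · refine aestronglyMeasurable_of_tendsto_ae Filter.atTop
        (f := fun n s => ∑ i ∈ Finset.range n, F i s)
        (fun n => (continuous_finsetSum _ fun i _ => hFc i).aestronglyMeasurable) ?_
      exact ae_restrict_of_forall_mem measurableSet_uIoc fun s hs => (hsum s hs).tendsto_sum_nat
    · refine ae_restrict_of_forall_mem measurableSet_uIoc fun s hs => ?_
      rw [← (hsum s hs).tsum_eq]
      exact tsum_of_norm_bounded (hbd s hs) fun n => hFle n s hs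
  · have hFTC : ∀ n, lam * ∫ s in (0 : ℝ)..t, F n s =
        wildWeight q lam n t * p n - wildWeight q lam n 0 * p n := fun n => by
      rw [← intervalIntegral.integral_const_mul]
      refine intervalIntegral.integral_eq_sub_of_hasDerivAt
        (f := fun s => wildWeight q lam n s * p n) (fun s _ => ?_)
        ((hFc n).const_mul lam |>.intervalIntegrable _ _)
      refine ((hasDerivAt_wildWeight q lam n s).mul_const (p n)).congr_deriv ?_
      simp only [hF]
      ring
    -- At time `0` the ratio `1 - e^0` vanishes, so only the term `n = 0` survives.
    have h0 : HasSum (fun n => wildWeight q lam n 0 * p n) ((μ₀ : Measure ℝ).real B) := by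
      have : (μ₀ : Measure ℝ).real B = wildWeight q lam 0 0 * p 0 := by
        simp [wildWeight, hp, wildCoeff_one, convPow_one]
      rw [this]
      refine hasSum_single 0 fun n hn => ?_
      simp [wildWeight, hn]
    have h1 := (hasSum_wildMeasure hq hlam t.coe_nonneg (μ₀ : Measure ℝ) hB).sub h0
    have h2 := hint.mul_left lam
    simp only [hFTC] at h2
    have := h1.unique h2
    linarith

end

/-- The evolution equation for meetings of size `m` has exactly one solution, and it is the
generalized Wild sum. The summation index `n : ℕ` here is the usual index `n ≥ 1` minus one. -/
theorem proposition3 (m : ℕ) (hm : 2 ≤ m) (lam : ℝ) (hlam : 0 < lam)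
    (μ₀ : ProbabilityMeasure ℝ) :
    ∃ μ : ℝ≥0 → ProbabilityMeasure ℝ,
      IsEvolutionSolution m lam μ₀ μ ∧
      (∀ μ' : ℝ≥0 → ProbabilityMeasure ℝ, IsEvolutionSolution m lam μ₀ μ' → μ' = μ) ∧
      ∀ (t : ℝ≥0) (B : Set ℝ), MeasurableSet B →
        HasSum
          (fun n : ℕ =>
            wildCoeff m (n + 1) * Real.exp (-(lam * t)) *
              (1 - Real.exp (-(((m : ℝ) - 1) * lam * t))) ^ n *
              (convPow (μ₀ : Measure ℝ) ((m - 1) * n + 1)).real B)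
          ((μ t : Measure ℝ).real B) := by
  obtain ⟨q, rfl⟩ : ∃ q, m = q + 1 := ⟨m - 1, by omega⟩
  have hq : 1 ≤ q := by omega
  have hsol := wildMeasure_isEvolutionSolution hq hlam μ₀
  refine ⟨_, hsol, fun μ' h' => h'.unique hlam hsol, fun t B hB => ?_⟩
  have h := hasSum_wildMeasure hq hlam t.coe_nonneg (μ₀ : Measure ℝ) hB
  simp only [Nat.add_sub_cancel, Nat.cast_succ, add_sub_cancel_right]
  exact h
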